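/- Let $M$ be a smooth manifold (finite-dimensional, Hausdorff, second countable, without boundary) and let $\mathbb E$ be a finite-dimensional real Banach space. Let $\mathtt f$ be a Lipschitz-vector-field structure on $M$ modelled by $\mathbb E$, i.e., a section of $\mathbb E^*\otimes TM$ (for each $p\in M$ a linear map $\mathtt f(p,\cdot):\mathbb E\to T_pM$) that is locally Lipschitz, meaning that every point of $M$ has a coordinate neighborhood in whose induced trivialization $\mathtt f$ is Lipschitz. Let $N:M\times\mathbb E\to[0,+\infty)$ be a continuously varying norm, i.e., a continuous function such that $N(p,\cdot)$ is a norm on $\mathbb E$ for every $p\in M$. For $p,q\in M$ let $$d_{(\mathtt f,N)}(p,q):=\inf\Big\{\operatorname*{ess\,sup}_{t\in[0,1]}N(\gamma(t),u(t))\Big\}\in[0,+\infty],$$ where the infimum is over all $u\in L^\infty([0,1];\mathbb E)$ for which the Cauchy problem $\gamma'(t)=\mathtt f(\gamma(t),u(t))$ for a.e. $t\in[0,1]$, $\gamma(0)=p$, has an absolutely continuous solution $\gamma:[0,1]\to M$ with $\gamma(1)=q$. For $v\in T_pM$ let $$|v|_{(\mathtt f,N)}:=\inf\{N(p,u):u\in\mathbb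 E,\ \mathtt f(p,u)=v\}\in[0,+\infty].$$ In both definitions $\inf\emptyset=+\infty$. Then, for all real numbers $a<b$ and all $p,q\in M$, $$d_{(\mathtt f,N)}(p,q)=\inf\left\{\int_a^b|\gamma'(t)|_{(\mathtt f,N)}\,dt\ :\ \gamma:[a,b]\to M\text{ absolutely continuous},\ \gamma(a)=p,\ \gamma(b)=q\right\},$$ as elements of $[0,+\infty]$ (again with $\inf\emptyset=+\infty$). -/

import Mathlib

open MeasureTheory Set
open scoped Manifold ContDiff ENNReal

noncomputable section

/-! Throughout, `M` is a smooth manifold (without boundary) modelled on a finite-dimensional real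
vector space `V`, and `E` is a finite-dimensional real Banach space.  Curves are represented by
functions `ℝ → M` of which only the values on the relevant compact interval matter. -/

namespace CarnotCaratheodory

variable {V : Type*} [NormedAddCommGroup V] [NormedSpace ℝ V]
  {M : Type*} [TopologicalSpace M] [ChartedSpace V M]
  {E : Type*} [NormedAddCommGroup E] [NormedSpace ℝ E]

/-- The expression of a section `f` of `E* ⊗ TM` in the coordinates given by the chart `φ`: the
point of coordinates `x` is sent to the linear map `dφ ∘ f : E → V` at that point. -/
def coordRep (f : ∀ p : M, E →L[ℝ] TangentSpace 𝓘(ℝ, V) p)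
    (φ : OpenPartialHomeomorph M V) (x : V) : E →L[ℝ] V :=
  (mfderiv 𝓘(ℝ, V) 𝓘(ℝ, V) φ (φ.symm x)).comp (f (φ.symm x))

/-- `f` is a Lipschitz-vector-field structure on `M` modelled by `E`: a section of `E* ⊗ TM` which
around every point is Lipschitz in the trivialization induced by some smooth chart. -/
def IsLipschitzStructure (f : ∀ p : M, E →L[ℝ] TangentSpace 𝓘(ℝ, V) p) : Prop :=
  ∀ p : M, ∃ φ ∈ IsManifold.maximalAtlas 𝓘(ℝ, V) ∞ M, p ∈ φ.source ∧
    ∃ L : NNReal, LipschitzOnWith L (coordRep f φ) φ.target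

/-- `N` is a continuously varying norm on `M × E`: it is (jointly) continuous, and it is a norm on
each fibre. -/
structure IsContinuouslyVaryingNorm (N : M → E → ℝ) : Prop where
  continuous : Continuous fun x : M × E => N x.1 x.2
  nonneg : ∀ p u, 0 ≤ N p u
  eq_zero : ∀ p u, N p u = 0 → u = 0
  smul : ∀ p (c : ℝ) u, N p (c • u) = |c| * N p u
  triangle : ∀ p u v, N p (u + v) ≤ N p u + N p v

variable (V) in
/-- The curve `γ : [a,b] → M` is absolutely continuous: it is continuous, and it is absolutely
continuous in every smooth chart, on each compact subinterval that it maps into the domain of the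
chart. -/
def IsAbsolutelyContinuousCurve (γ : ℝ → M) (a b : ℝ) : Prop :=
  ContinuousOn γ (Icc a b) ∧
    ∀ φ ∈ IsManifold.maximalAtlas 𝓘(ℝ, V) ∞ M, ∀ c d : ℝ, a ≤ c → c ≤ d → d ≤ b →
      MapsTo γ (Icc c d) φ.source → AbsolutelyContinuousOnInterval (fun t => φ (γ t)) c d

variable (V) in
/-- The velocity `γ'(t)`, a tangent vector at `γ t`. -/
def velocity (γ : ℝ → M) (t : ℝ) : TangentSpace 𝓘(ℝ, V) (γ t) :=
  mfderiv 𝓘(ℝ, ℝ) 𝓘(ℝ, V) γ t (1 : ℝ)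

/-- `γ : [0,1] → M` is the solution of the Cauchy problem `γ' = f(γ, u)`, `γ 0 = o` with control
`u : [0,1] → E`, in the sense of Carathéodory: `γ` is absolutely continuous and the equation holds
at almost every time.  In this case, `(o, f, u)` is in the domain of the end-point map, and the
end-point is `γ 1`. -/
structure IsSolution (f : ∀ p : M, E →L[ℝ] TangentSpace 𝓘(ℝ, V) p) (o : M) (u : ℝ → E)
    (γ : ℝ → M) : Prop where
  absolutelyContinuous : IsAbsolutelyContinuousCurve V γ 0 1
  initial : γ 0 = o
  equation : ∀ᵐ t ∂volume.restrict (Icc (0 : ℝ) 1),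
    MDifferentiableAt 𝓘(ℝ, ℝ) 𝓘(ℝ, V) γ t ∧ velocity V γ t = f (γ t) (u t)

/-- The energy of the control `u` with trajectory `γ`:
the essential supremum over `t ∈ [0,1]` of `N(γ t, u t)`. -/
def energy (N : M → E → ℝ) (u : ℝ → E) (γ : ℝ → M) : ℝ≥0∞ :=
  essSup (fun t => ENNReal.ofReal (N (γ t) (u t))) (volume.restrict (Icc (0 : ℝ) 1))

/-- The Carnot-Carathéodory distance between `p` and `q`: the infimum (`∞` if there is none) of the
energies of the controls `u ∈ L^∞([0,1]; E)` whose solution `γ` starting at `p` exists on `[0,1]`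
and ends at `q`.  Here controls are given by representatives of their class; all the
notions involved are unaffected by changes on null sets. -/
def ccDist (f : ∀ p : M, E →L[ℝ] TangentSpace 𝓘(ℝ, V) p) (N : M → E → ℝ) (p q : M) : ℝ≥0∞ :=
  ⨅ (u : ℝ → E) (γ : ℝ → M) (_ : MemLp u ∞ (volume.restrict (Icc (0 : ℝ) 1)))
    (_ : IsSolution f p u γ) (_ : γ 1 = q), energy N u γ

/-- The sub-Finsler metric `|v|_(f,N) = inf {N(p,u) : f(p,u) = v}` of a tangent vector `v` at `p`,
which is `∞` if `v` is not in the image of `f` at `p`. -/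
def subFinsler (f : ∀ p : M, E →L[ℝ] TangentSpace 𝓘(ℝ, V) p) (N : M → E → ℝ) (p : M)
    (v : TangentSpace 𝓘(ℝ, V) p) : ℝ≥0∞ :=
  ⨅ (u : E) (_ : f p u = v), ENNReal.ofReal (N p u)

/-- The length `∫_a^b |γ'(t)|_(f,N) dt` of `γ : [a,b] → M`. -/
def subFinslerLength (f : ∀ p : M, E →L[ℝ] TangentSpace 𝓘(ℝ, V) p) (N : M → E → ℝ)
    (γ : ℝ → M) (a b : ℝ) : ℝ≥0∞ :=
  ∫⁻ t in Icc a b, subFinsler f N (γ t) (velocity V γ t)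

end CarnotCaratheodory

end

/-! Both inequalities come from reparametrization. A trajectory on `[0,1]` run affinely over `[a,b]`
has its control divided by `b - a`, so its speed is a.e. at most energy`/(b - a)` and its length at
most the energy.

Conversely, an absolutely continuous curve of finite length admits a measurable control `u` whose
cost exceeds the speed by at most `ε` a.e. Parametrizing proportionally to the integral of a density
`g ≥ N(γ,u)` of total mass `L` multiplies the control by `L/g`, so its cost is at most `L` a.e.; `L`
is at most the length plus `2ε(b - a)`, and `ε` tends to `0`.

Two facts carry this. `exists_measurable_almost_minimizer` selects `u` among the solutions of a
linear equation, by a Borel generalized inverse and a dense sequence of parameters.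
`exists_timeChange` shows that a density bounded below gives a Lipschitz time change, which
preserves absolute continuity, and a nonsingular one, which transports a.e. statements. -/

/-! ### Measurable selection of almost optimal solutions of linear equations -/

section Selection

variable {V : Type*} [NormedAddCommGroup V] [NormedSpace ℝ V]
  {E : Type*} [NormedAddCommGroup E] [NormedSpace ℝ E] [FiniteDimensional ℝ E]

theorem ContinuousLinearMap.secondCountableTopology_of_finiteDimensional
    [FiniteDimensional ℝ V] :
    SecondCountableTopology (E →L[ℝ] V) := by
  have : ProperSpace (E →L[ℝ] V) := FiniteDimensional.proper ℝ _
  infer_instance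

theorem measurable_ringInverse {R : Type*} [NormedRing R] [CompleteSpace R] [MeasurableSpace R]
    [BorelSpace R] : Measurable (Ring.inverse : R → R) := by
  classical
  have h : (Ring.inverse : R → R) = {x : R | IsUnit x}.piecewise Ring.inverse (fun _ => 0) := by
    funext x
    by_cases hx : IsUnit x
    · rw [Set.piecewise_eq_of_mem _ _ _ (by exact hx)]
    · rw [Set.piecewise_eq_of_notMem _ _ _ (by exact hx), Ring.inverse_non_unit _ hx]
  rw [h]
  refine ContinuousOn.measurable_piecewise ?_ continuousOn_const Units.isOpen.measurableSet
  rintro _ ⟨x, rfl⟩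
  exact (NormedRing.inverse_continuousAt x).continuousWithinAt

/-- If `P A Q` is invertible and `Q` has rank `rank A`, then `Q (P A Q)⁻¹ P` is a generalized
inverse of `A`. -/
theorem comp_ringInverse_comp_eq_self {r : ℕ} {A : E →L[ℝ] V} (P : V →L[ℝ] (Fin r → ℝ))
    (Q : (Fin r → ℝ) →L[ℝ] E) (hr : Module.finrank ℝ (A : E →ₗ[ℝ] V).range = r)
    (hu : IsUnit (P ∘L A ∘L Q)) (x : E) :
    A (Q (Ring.inverse (P ∘L A ∘L Q) (P (A x)))) = A x := by
  have hinv : ∀ z, Ring.inverse (P ∘L A ∘L Q) (P (A (Q z))) = z := fun z => by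
    have := congrArg (fun T => T z) (Ring.inverse_mul_cancel _ hu)
    simpa using this
  have hinj : Function.Injective ((A ∘L Q : (Fin r → ℝ) →L[ℝ] V) : (Fin r → ℝ) →ₗ[ℝ] V) := by
    refine Function.LeftInverse.injective (g := fun y => Ring.inverse (P ∘L A ∘L Q) (P y)) ?_
    intro z
    exact hinv z
  have hle : ((A ∘L Q : (Fin r → ℝ) →L[ℝ] V) : (Fin r → ℝ) →ₗ[ℝ] V).range ≤
      (A : E →ₗ[ℝ] V).range := by
    rintro _ ⟨z, rfl⟩
    exact ⟨Q z, rfl⟩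
  -- `A ∘ Q` is injective on a space of dimension `rank A`, so it already fills the range of `A`:
  -- every `A x` is some `A (Q z)`.
  have heq := Submodule.eq_of_le_of_finrank_eq hle (by
    rw [LinearMap.finrank_range_of_inj hinj, hr]; simp)
  have hx : A x ∈ (A : E →ₗ[ℝ] V).range := ⟨x, rfl⟩
  rw [← heq] at hx
  obtain ⟨z, hz⟩ := hx
  have hz' : A (Q z) = A x := hz
  rw [← hz', hinv]

/-- Take `Q` to be a section of `A` over coordinates on its range, and `P` a projection onto the
range followed by these coordinates; the composite is the identity. -/
theorem exists_isUnit_comp [FiniteDimensional ℝ V] (A : E →L[ℝ] V) {r : ℕ}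
    (hr : Module.finrank ℝ (A : E →ₗ[ℝ] V).range = r) :
    ∃ (P : V →L[ℝ] (Fin r → ℝ)) (Q : (Fin r → ℝ) →L[ℝ] E), IsUnit (P ∘L A ∘L Q) := by
  let R := (A : E →ₗ[ℝ] V).range
  let e : R ≃ₗ[ℝ] (Fin r → ℝ) := LinearEquiv.ofFinrankEq _ _ (by simpa using hr)
  obtain ⟨π, hπ⟩ := R.subtype.exists_leftInverse_of_injective R.ker_subtype
  obtain ⟨s, hs⟩ := (A : E →ₗ[ℝ] V).rangeRestrict.exists_rightInverse_of_surjective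
    (LinearMap.range_rangeRestrict _)
  refine ⟨LinearMap.toContinuousLinearMap (e.toLinearMap ∘ₗ π),
    LinearMap.toContinuousLinearMap (s ∘ₗ e.symm.toLinearMap), ?_⟩
  convert isUnit_one
  ext1 z
  have h1 : A (s (e.symm z)) = (e.symm z : V) := congrArg Subtype.val (LinearMap.congr_fun hs _)
  have h2 : π (e.symm z : V) = e.symm z := LinearMap.congr_fun hπ _
  simp [h1, h2]

/-- A generalized inverse of a linear map can be chosen in a Borel measurable way. -/
theorem exists_measurable_pseudoinverse [FiniteDimensional ℝ V]
    [MeasurableSpace (E →L[ℝ] V)] [BorelSpace (E →L[ℝ] V)]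
    [MeasurableSpace (V →L[ℝ] E)] [BorelSpace (V →L[ℝ] E)] :
    ∃ G : (E →L[ℝ] V) → (V →L[ℝ] E), Measurable G ∧ ∀ (A : E →L[ℝ] V) (x : E), A (G A (A x)) = A x := by
  classical
  have hsc1 : ∀ r, SecondCountableTopology (V →L[ℝ] (Fin r → ℝ)) := fun r =>
    ContinuousLinearMap.secondCountableTopology_of_finiteDimensional
  have hsc2 : ∀ r, SecondCountableTopology ((Fin r → ℝ) →L[ℝ] E) := fun r =>
    ContinuousLinearMap.secondCountableTopology_of_finiteDimensional
  -- Countably many Borel candidates, indexed by a rank and two positions in dense sequences of `P`s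
  -- and `Q`s. Each `A` is served by one of them because invertibility of `P A Q` is an open
  -- condition on `(P, Q)`; the first that works is used.
  let cand : ℕ × ℕ × ℕ → (E →L[ℝ] V) → (V →L[ℝ] E) := fun k A =>
    let P := TopologicalSpace.denseSeq (V →L[ℝ] (Fin k.1 → ℝ)) k.2.1
    let Q := TopologicalSpace.denseSeq ((Fin k.1 → ℝ) →L[ℝ] E) k.2.2
    Q ∘L Ring.inverse (P ∘L A ∘L Q) ∘L P
  have hcand : ∀ k, Measurable (cand k) := by
    intro k
    borelize ((Fin k.1 → ℝ) →L[ℝ] (Fin k.1 → ℝ))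
    let P := TopologicalSpace.denseSeq (V →L[ℝ] (Fin k.1 → ℝ)) k.2.1
    let Q := TopologicalSpace.denseSeq ((Fin k.1 → ℝ) →L[ℝ] E) k.2.2
    have h1 : Continuous fun A : E →L[ℝ] V => P ∘L A ∘L Q := by fun_prop
    have h2 : Continuous fun B : (Fin k.1 → ℝ) →L[ℝ] (Fin k.1 → ℝ) => Q ∘L B ∘L P := by fun_prop
    exact h2.measurable.comp (measurable_ringInverse.comp h1.measurable)
  have hp : ∀ k, MeasurableSet {A : E →L[ℝ] V | ∀ x, A (cand k A (A x)) = A x} := by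
    intro k
    borelize V
    obtain ⟨s, hs, hd⟩ := TopologicalSpace.exists_countable_dense E
    have hset : {A : E →L[ℝ] V | ∀ x, A (cand k A (A x)) = A x} =
        ⋂ x ∈ s, {A : E →L[ℝ] V | A (cand k A (A x)) = A x} := by
      ext A
      simp only [mem_ofPred_eq, mem_iInter]
      refine ⟨fun h x _ => h x, fun h x => ?_⟩
      have := Continuous.ext_on hd (f := fun x => A (cand k A (A x))) (g := A) (by fun_prop)
        (by fun_prop) (fun x hx => h x hx)
      exact congrFun this x
    rw [hset]
    refine MeasurableSet.biInter hs fun x _ => ?_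
    have hsc4 : SecondCountableTopology (V →L[ℝ] E) :=
      ContinuousLinearMap.secondCountableTopology_of_finiteDimensional
    have hsc5 : SecondCountableTopology (E →L[ℝ] V) :=
      ContinuousLinearMap.secondCountableTopology_of_finiteDimensional
    have hc : Continuous fun y : (E →L[ℝ] V) × (V →L[ℝ] E) => y.1 (y.2 (y.1 x)) := by fun_prop
    exact measurableSet_eq_fun (hc.measurable.comp (measurable_id.prodMk (hcand k)))
      (by fun_prop : Continuous fun A : E →L[ℝ] V => A x).measurable
  have hex : ∀ A : E →L[ℝ] V, ∃ k, ∀ x, A (cand k A (A x)) = A x := by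
    intro A
    obtain ⟨r, hr⟩ : ∃ r, Module.finrank ℝ (A : E →ₗ[ℝ] V).range = r := ⟨_, rfl⟩
    obtain ⟨P, Q, hPQ⟩ := exists_isUnit_comp A hr
    have hopen : IsOpen {y : (V →L[ℝ] (Fin r → ℝ)) × ((Fin r → ℝ) →L[ℝ] E) |
        IsUnit (y.1 ∘L A ∘L y.2)} :=
      Units.isOpen.preimage (by fun_prop)
    obtain ⟨⟨i, j⟩, hy⟩ := ((TopologicalSpace.denseRange_denseSeq
      (V →L[ℝ] (Fin r → ℝ))).prodMap (TopologicalSpace.denseRange_denseSeq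
      ((Fin r → ℝ) →L[ℝ] E))).exists_mem_open hopen ⟨(P, Q), hPQ⟩
    refine ⟨(r, i, j), fun x => comp_ringInverse_comp_eq_self _ _ hr hy x⟩
  let en : ℕ → ℕ × ℕ × ℕ := (Denumerable.eqv (ℕ × ℕ × ℕ)).symm
  have hex' : ∀ A : E →L[ℝ] V, ∃ n, ∀ x, A (cand (en n) A (A x)) = A x := fun A => by
    obtain ⟨k, hk⟩ := hex A
    exact ⟨Denumerable.eqv _ k, by simpa [en] using hk⟩
  refine ⟨fun A => cand (en (Nat.find (hex' A))) A, ?_, fun A => Nat.find_spec (hex' A)⟩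
  exact Measurable.find (fun n => hcand (en n)) (fun n => hp (en n)) hex'

/-- Measurable selection of an almost optimal solution of a linear equation depending measurably on
a parameter. -/
theorem exists_measurable_almost_minimizer [FiniteDimensional ℝ V]
    {Ω : Type*} [MeasurableSpace Ω]
    [MeasurableSpace E] [BorelSpace E] [MeasurableSpace V] [BorelSpace V]
    [MeasurableSpace (E →L[ℝ] V)] [BorelSpace (E →L[ℝ] V)]
    {A : Ω → E →L[ℝ] V} (hA : Measurable A) {w : Ω → V} (hw : Measurable w)
    {n : Ω → E → ℝ} (hn : ∀ t, Continuous (n t)) (hn' : ∀ e, Measurable fun t => n t e)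
    (hn0 : ∀ t e, 0 ≤ n t e) {ε : ℝ} (hε : 0 < ε) :
    ∃ u : Ω → E, Measurable u ∧ MeasurableSet {t | w t ∈ range (A t)} ∧
      ∀ t, w t ∈ range (A t) → A t (u t) = w t ∧ ∀ e, A t e = w t → n t (u t) ≤ n t e + ε := by
  classical
  borelize (V →L[ℝ] E)
  obtain ⟨G, hG, hAGA⟩ := exists_measurable_pseudoinverse (E := E) (V := V)
  have hsc4 : SecondCountableTopology (V →L[ℝ] E) :=
    ContinuousLinearMap.secondCountableTopology_of_finiteDimensional
  have hsc5 : SecondCountableTopology (E →L[ℝ] V) :=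
    ContinuousLinearMap.secondCountableTopology_of_finiteDimensional
  -- When the equation is solvable, `e ↦ sol e t` retracts `E` continuously onto its solution set,
  -- so a dense sequence of parameters `e` reaches a dense set of solutions.
  let sol : E → Ω → E := fun e t => e + G (A t) (w t - A t e)
  have hsol : ∀ e, Measurable (sol e) := fun e => by
    have hc : Continuous fun y : (V →L[ℝ] E) × (E →L[ℝ] V) × V => e + y.1 (y.2.2 - y.2.1 e) := by
      fun_prop
    exact hc.measurable.comp ((hG.comp hA).prodMk (hA.prodMk hw))
  have hsolc : ∀ t, Continuous fun e => sol e t := fun t => by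
    simp only [sol]; fun_prop
  have hsol_eq : ∀ e t, w t ∈ range (A t) → A t (sol e t) = w t := by
    rintro e t ⟨x, hx⟩
    simp only [sol, map_add]
    rw [← hx, ← map_sub, hAGA]
    simp
  have hsol_fix : ∀ e t, A t e = w t → sol e t = e := fun e t h => by simp [sol, h]
  have hS : MeasurableSet {t | w t ∈ range (A t)} := by
    have : {t | w t ∈ range (A t)} = {t | A t (sol 0 t) = w t} := by
      ext t
      exact ⟨fun h => hsol_eq 0 t h, fun h => ⟨_, h⟩⟩
    rw [this]
    have hc : Continuous fun y : (E →L[ℝ] V) × E => y.1 y.2 := by fun_prop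
    exact measurableSet_eq_fun (hc.measurable.comp (hA.prodMk (hsol 0))) hw
  let d : ℕ → E := TopologicalSpace.denseSeq E
  have hd : DenseRange d := TopologicalSpace.denseRange_denseSeq E
  let F : ℕ → Ω → ℝ := fun k t => n t (sol (d k) t)
  have hn2 : Measurable fun y : Ω × E => n y.1 y.2 :=
    (measurable_uncurry_of_continuous_of_measurable (u := fun e t => n t e)
      (fun t => hn t) hn').comp measurable_swap
  have hF : ∀ k, Measurable (F k) := fun k => hn2.comp (measurable_id.prodMk (hsol (d k)))
  have hbdd : ∀ t, BddBelow (range fun k => F k t) := fun t => ⟨0, by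
    rintro _ ⟨k, rfl⟩; exact hn0 _ _⟩
  have hinf : Measurable fun t => ⨅ k, F k t := Measurable.iInf hF
  have hex : ∀ t, ∃ k, F k t < (⨅ k, F k t) + ε := fun t =>
    exists_lt_of_ciInf_lt (lt_add_of_pos_right _ hε)
  refine ⟨fun t => sol (d (Nat.find (hex t))) t,
    Measurable.find (f := fun k => sol (d k)) (fun k => hsol (d k))
      (fun k => measurableSet_lt (hF k) (hinf.add_const ε)) hex, hS,
    fun t ht => ⟨hsol_eq _ _ ht, fun e he => ?_⟩⟩
  refine (Nat.find_spec (hex t)).le.trans ?_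
  gcongr
  -- By continuity in `e`, the infimum over the dense sequence bounds the cost of every `sol e t`,
  -- hence of every exact solution, which `sol` fixes.
  have hclosed : IsClosed {e | (⨅ k, F k t) ≤ n t (sol e t)} :=
    isClosed_le continuous_const ((hn t).comp (hsolc t))
  have hall : ∀ e, (⨅ k, F k t) ≤ n t (sol e t) := fun e =>
    hd.induction_on e hclosed fun k => ciInf_le (hbdd t) k
  simpa [hsol_fix e t he] using hall e

end Selection

/-! ### Change of time -/

section TimeChange

/-- The inverse of a primitive of a locally integrable function bounded below by a positive
constant is a Lipschitz nonsingular change of variables. -/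
theorem exists_timeChange {h : ℝ → ℝ} (hh : LocallyIntegrable h) {c : ℝ} (hc : 0 < c)
    (hle : ∀ t, c ≤ h t) (a x₀ : ℝ) :
    ∃ σ : ℝ → ℝ, Monotone σ ∧ (∃ K : NNReal, LipschitzWith K σ) ∧
      Measure.QuasiMeasurePreserving σ volume volume ∧
      (∀ᵐ r, HasDerivAt σ (h (σ r))⁻¹ r) ∧ ∀ t, σ (x₀ + ∫ x in a..t, h x) = t := by
  have hint : ∀ x y, IntervalIntegrable h volume x y := fun x y =>
    intervalIntegrable_iff.mpr <|
      (hh.integrableOn_isCompact isCompact_uIcc).mono_set uIoc_subset_uIcc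
  let s : ℝ → ℝ := fun t => x₀ + ∫ x in a..t, h x
  have hsub : ∀ x y, s y - s x = ∫ t in x..y, h t := fun x y => by
    simp only [s, add_sub_add_left_eq_sub]
    exact intervalIntegral.integral_interval_sub_left (hint _ _) (hint _ _)
  have hlow : ∀ x y, x ≤ y → c * (y - x) ≤ s y - s x := fun x y hxy => by
    rw [hsub]
    calc c * (y - x) = ∫ t in x..y, c := by simp [mul_comm]
      _ ≤ ∫ t in x..y, h t := intervalIntegral.integral_mono_on hxy (by simp) (hint _ _)
          fun t _ => hle t
  have hmono : StrictMono s := fun x y hxy => by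
    have := hlow x y hxy.le
    nlinarith
  have hcont : Continuous s :=
    continuous_const.add (intervalIntegral.continuous_primitive hint a)
  have hsurj : Function.Surjective s := by
    refine hcont.surjective ?_ ?_
    · refine Filter.tendsto_atTop_mono' _ (f₁ := fun t => s 0 + c * t) ?_
        (Filter.tendsto_atTop_add_const_left _ _ (Filter.tendsto_id.const_mul_atTop hc))
      filter_upwards [Filter.eventually_ge_atTop 0] with t ht
      linarith [hlow 0 t ht]
    · refine Filter.tendsto_atBot_mono' _ (f₁ := fun t => s 0 + c * t) ?_
        (Filter.tendsto_atBot_add_const_left _ _ (Filter.tendsto_id.const_mul_atBot hc))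
      filter_upwards [Filter.eventually_le_atBot 0] with t ht
      linarith [hlow t 0 ht]
  let e : ℝ ≃o ℝ := hmono.orderIsoOfSurjective s hsurj
  have hes : ∀ t, e.symm (s t) = t := fun t => e.symm_apply_apply t
  have hse : ∀ r, s (e.symm r) = r := fun r => e.apply_symm_apply r
  have hecont : Continuous e.symm := e.symm.continuous
  -- Lebesgue measure is the image under `s` of `h dt`, so the preimage of `Z` under `s⁻¹` has
  -- measure `∫_Z h`, which vanishes for null `Z`. This is the nonsingularity of `s⁻¹`.
  have hmap : volume = (volume.withDensity fun t => ENNReal.ofReal (h t)).map s := by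
    refine Real.measure_ext_Ioo_rat fun p q => ?_
    have hpre : s ⁻¹' Ioo (p : ℝ) q = Ioo (e.symm p) (e.symm q) := by
      ext t
      have h1 : e.symm p < t ↔ (p : ℝ) < s t := by
        conv_rhs => rw [← hse p]
        exact hmono.lt_iff_lt.symm
      have h2 : t < e.symm q ↔ s t < q := by
        conv_rhs => rw [← hse q]
        exact hmono.lt_iff_lt.symm
      simp [h1, h2]
    rw [Measure.map_apply hcont.measurable measurableSet_Ioo, hpre,
      withDensity_apply _ measurableSet_Ioo, Real.volume_Ioo]
    rcases le_total (p : ℝ) q with hpq | hpq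
    · have hpq' : e.symm (p : ℝ) ≤ e.symm q := e.symm.monotone hpq
      rw [setLIntegral_congr Ioo_ae_eq_Ioc, ← ofReal_integral_eq_lintegral_ofReal (hint _ _).1
        (Filter.Eventually.of_forall fun t => hc.le.trans (hle t)),
        ← intervalIntegral.integral_of_le hpq', ← hsub, hse, hse]
    · rw [Ioo_eq_empty (e.symm.monotone hpq).not_gt, ENNReal.ofReal_of_nonpos (by linarith)]
      simp
  have hqmp : Measure.QuasiMeasurePreserving e.symm volume volume := by
    refine ⟨hecont.measurable, Measure.AbsolutelyContinuous.mk fun Z hZ hZ0 => ?_⟩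
    rw [Measure.map_apply hecont.measurable hZ, hmap,
      Measure.map_apply hcont.measurable (hecont.measurable hZ)]
    have : s ⁻¹' (e.symm ⁻¹' Z) = Z := by
      ext t
      simp only [mem_preimage, hes]
    rw [this]
    exact withDensity_absolutelyContinuous _ _ hZ0
  refine ⟨e.symm, e.symm.monotone, ⟨Real.toNNReal c⁻¹, ?_⟩, hqmp, ?_, hes⟩
  · refine LipschitzWith.of_le_add_mul' _ fun x y => ?_
    rcases le_total x y with hxy | hxy
    · have := e.symm.monotone hxy
      have : 0 ≤ c⁻¹ * dist x y := by positivity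
      linarith
    · have := hlow _ _ (e.symm.monotone hxy)
      rw [hse, hse] at this
      rw [Real.dist_eq, abs_of_nonneg (by linarith), inv_mul_eq_div, ← sub_le_iff_le_add',
        le_div_iff₀ hc]
      linarith
  · have hder : ∀ᵐ t, HasDerivAt s (h t) t := by
      filter_upwards [LocallyIntegrable.ae_hasDerivAt_integral hh] with t ht using (ht a).const_add x₀
    filter_upwards [hqmp.ae hder] with r hr
    exact hr.of_local_left_inverse hecont.continuousAt (hc.trans_le (hle _)).ne'
      (Filter.Eventually.of_forall hse)

end TimeChange

/-! ### Reparametrization and velocity of curves -/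

section Curves

theorem AbsolutelyContinuousOnInterval.comp_monotone_lipschitz {X : Type*} [PseudoMetricSpace X]
    {f : ℝ → X} {σ : ℝ → ℝ} {c d : ℝ} (hf : AbsolutelyContinuousOnInterval f (σ c) (σ d))
    (hσ : Monotone σ) {K : NNReal} (hK : LipschitzWith K σ) :
    AbsolutelyContinuousOnInterval (fun t => f (σ t)) c d := by
  rw [absolutelyContinuousOnInterval_iff] at hf ⊢
  intro ε hε
  obtain ⟨δ, hδ, h⟩ := hf ε hε
  -- `K + 1` instead of `K` covers the case `K = 0`.
  refine ⟨δ / (K + 1), by positivity, fun I hI hlen => ?_⟩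
  refine h (I.1, fun i => (σ (I.2 i).1, σ (I.2 i).2)) ⟨fun i hi => ?_, fun i hi j hj hij => ?_⟩ ?_
  · exact ⟨hσ.mapsTo_uIcc (hI.1 i hi).1, hσ.mapsTo_uIcc (hI.1 i hi).2⟩
  · have hdis := hI.2 hi hj hij
    simp only [Function.onFun, uIoc, disjoint_left, mem_Ioc] at hdis ⊢
    rw [← hσ.map_min, ← hσ.map_max, ← hσ.map_min, ← hσ.map_max]
    rintro z ⟨h1, h2⟩ ⟨h3, h4⟩
    -- If two image intervals met, each left end would lie below each right end before applying `σ`,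
    -- so the smaller right end would belong to both original intervals.
    have h12 := hσ.reflect_lt (h1.trans_le h2)
    have h14 := hσ.reflect_lt (h1.trans_le h4)
    have h32 := hσ.reflect_lt (h3.trans_le h2)
    have h34 := hσ.reflect_lt (h3.trans_le h4)
    exact hdis ⟨lt_min h12 h14, min_le_left _ _⟩ ⟨lt_min h32 h34, min_le_right _ _⟩
  · calc ∑ i ∈ Finset.range I.1, dist (σ (I.2 i).1) (σ (I.2 i).2)
        ≤ ∑ i ∈ Finset.range I.1, K * dist (I.2 i).1 (I.2 i).2 :=
          Finset.sum_le_sum fun i _ => hK.dist_le_mul _ _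
      _ = K * ∑ i ∈ Finset.range I.1, dist (I.2 i).1 (I.2 i).2 := by rw [Finset.mul_sum]
      _ ≤ (K + 1) * ∑ i ∈ Finset.range I.1, dist (I.2 i).1 (I.2 i).2 := by
          gcongr
          linarith
      _ < (K + 1) * (δ / (K + 1)) := by gcongr
      _ = δ := by field_simp

namespace CarnotCaratheodory

variable {V : Type*} [NormedAddCommGroup V] [NormedSpace ℝ V]
  {M : Type*} [TopologicalSpace M] [ChartedSpace V M]
  {E : Type*} [NormedAddCommGroup E] [NormedSpace ℝ E]

theorem IsAbsolutelyContinuousCurve.comp_monotone_lipschitz {γ : ℝ → M} {σ : ℝ → ℝ} {c d : ℝ}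
    (hγ : IsAbsolutelyContinuousCurve V γ (σ c) (σ d))
    (hσ : Monotone σ) {K : NNReal} (hK : LipschitzWith K σ) :
    IsAbsolutelyContinuousCurve V (fun t => γ (σ t)) c d := by
  refine ⟨hγ.1.comp hK.continuous.continuousOn (hσ.mapsTo_Icc), fun φ hφ c' d' hc hcd hd hm => ?_⟩
  refine AbsolutelyContinuousOnInterval.comp_monotone_lipschitz (f := fun t => φ (γ t))
    (hγ.2 φ hφ (σ c') (σ d') (hσ hc) (hσ hcd) (hσ hd) fun t ht => ?_) hσ hK
  obtain ⟨r, hr, rfl⟩ := intermediate_value_Icc hcd hK.continuous.continuousOn ht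
  exact hm hr

theorem velocity_comp {γ : ℝ → M} {σ : ℝ → ℝ} {r s' : ℝ}
    (hγ : MDifferentiableAt 𝓘(ℝ, ℝ) 𝓘(ℝ, V) γ (σ r)) (hσ : HasDerivAt σ s' r) :
    MDifferentiableAt 𝓘(ℝ, ℝ) 𝓘(ℝ, V) (fun t => γ (σ t)) r ∧
      velocity V (fun t => γ (σ t)) r = s' • velocity V γ (σ r) := by
  have hσm : MDifferentiableAt 𝓘(ℝ, ℝ) 𝓘(ℝ, ℝ) σ r :=
    hσ.differentiableAt.mdifferentiableAt
  refine ⟨hγ.comp r hσm, ?_⟩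
  have h := mfderiv_comp r hγ hσm
  have h2 : velocity V (fun t => γ (σ t)) r =
      mfderiv 𝓘(ℝ, ℝ) 𝓘(ℝ, V) γ (σ r) (mfderiv 𝓘(ℝ, ℝ) 𝓘(ℝ, ℝ) σ r (1 : ℝ)) :=
    congrArg (fun T => T (1 : ℝ)) h
  have h3 : mfderiv 𝓘(ℝ, ℝ) 𝓘(ℝ, ℝ) σ r (1 : ℝ) = s' • (1 : ℝ) := by
    rw [mfderiv_eq_fderiv, hσ.hasFDerivAt.fderiv]
    exact mul_comm (1 : ℝ) s'
  rw [h2, h3]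
  exact map_smul _ _ _

theorem mdifferentiable_of_mem_maximalAtlas [IsManifold 𝓘(ℝ, V) ∞ M]
    {φ : OpenPartialHomeomorph M V}
    (hφ : φ ∈ IsManifold.maximalAtlas 𝓘(ℝ, V) ∞ M) : φ.MDifferentiable 𝓘(ℝ, V) 𝓘(ℝ, V) :=
  ⟨(contMDiffOn_of_mem_maximalAtlas hφ).mdifferentiableOn (by simp),
    (contMDiffOn_symm_of_mem_maximalAtlas hφ).mdifferentiableOn (by simp)⟩

theorem coordRep_apply_chart (f : ∀ p : M, E →L[ℝ] TangentSpace 𝓘(ℝ, V) p)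
    {φ : OpenPartialHomeomorph M V} {p : M} (hp : p ∈ φ.source) (u : E) :
    coordRep f φ (φ p) u = mfderiv 𝓘(ℝ, V) 𝓘(ℝ, V) φ p (f p u) := by
  unfold coordRep
  rw [φ.left_inv hp]
  rfl

theorem mdifferentiableAt_of_chart [IsManifold 𝓘(ℝ, V) ∞ M] {φ : OpenPartialHomeomorph M V}
    (hφ : φ ∈ IsManifold.maximalAtlas 𝓘(ℝ, V) ∞ M) {γ : ℝ → M} {t : ℝ} (ht : γ t ∈ φ.source)
    (hc : ContinuousAt γ t) (hd : DifferentiableAt ℝ (fun s => φ (γ s)) t) :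
    MDifferentiableAt 𝓘(ℝ, ℝ) 𝓘(ℝ, V) γ t := by
  have h1 : MDifferentiableAt 𝓘(ℝ, ℝ) 𝓘(ℝ, V) (fun s => φ.symm (φ (γ s))) t :=
    ((mdifferentiable_of_mem_maximalAtlas hφ).mdifferentiableAt_symm (φ.map_source ht)).comp t
      hd.mdifferentiableAt
  refine h1.congr_of_eventuallyEq ?_
  filter_upwards [hc.eventually (φ.open_source.mem_nhds ht)] with s hs
  exact (φ.left_inv hs).symm

theorem mfderiv_chart_velocity [IsManifold 𝓘(ℝ, V) ∞ M] {φ : OpenPartialHomeomorph M V}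
    (hφ : φ ∈ IsManifold.maximalAtlas 𝓘(ℝ, V) ∞ M) {γ : ℝ → M} {t : ℝ} (ht : γ t ∈ φ.source)
    (hγ : MDifferentiableAt 𝓘(ℝ, ℝ) 𝓘(ℝ, V) γ t) :
    mfderiv 𝓘(ℝ, V) 𝓘(ℝ, V) φ (γ t) (velocity V γ t) = deriv (fun s => φ (γ s)) t := by
  have h := mfderiv_comp t ((mdifferentiable_of_mem_maximalAtlas hφ).mdifferentiableAt ht) hγ
  have h2 := congrArg (fun T => T (1 : ℝ)) h
  refine Eq.trans h2.symm ?_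
  rw [mfderiv_eq_fderiv]
  rfl

/-- The differential of a chart is injective, so the control equation can be solved in coordinates,
where the linear maps have the fixed target `V` and selection applies. -/
theorem apply_eq_velocity_iff [IsManifold 𝓘(ℝ, V) ∞ M]
    (f : ∀ p : M, E →L[ℝ] TangentSpace 𝓘(ℝ, V) p) {φ : OpenPartialHomeomorph M V}
    (hφ : φ ∈ IsManifold.maximalAtlas 𝓘(ℝ, V) ∞ M) {γ : ℝ → M} {t : ℝ} (ht : γ t ∈ φ.source)
    (hγ : MDifferentiableAt 𝓘(ℝ, ℝ) 𝓘(ℝ, V) γ t) (u : E) :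
    f (γ t) u = velocity V γ t ↔
      coordRep f φ (φ (γ t)) u = deriv (fun s => φ (γ s)) t := by
  rw [coordRep_apply_chart f ht, ← mfderiv_chart_velocity hφ ht hγ]
  exact ((mdifferentiable_of_mem_maximalAtlas hφ).mfderiv_injective ht).eq_iff.symm

end CarnotCaratheodory

end Curves

/-! ### Almost optimal controls along a curve -/

section ControlSelection

namespace CarnotCaratheodory

variable {V : Type*} [NormedAddCommGroup V] [NormedSpace ℝ V]
  {M : Type*} [TopologicalSpace M] [ChartedSpace V M]
  {E : Type*} [NormedAddCommGroup E] [NormedSpace ℝ E]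

/-- On `T`, the curve `γ` admits a measurable control `u` whose cost is dominated by a measurable
function `ψ`, up to `ε` not larger than the sub-Finsler norm of the velocity. -/
def HasAlmostOptimalControl (f : ∀ p : M, E →L[ℝ] TangentSpace 𝓘(ℝ, V) p) (N : M → E → ℝ)
    (γ : ℝ → M) (ε : ℝ) (T : Set ℝ) : Prop :=
  ∃ (u : ℝ → E) (ψ : ℝ → ℝ≥0∞), StronglyMeasurable u ∧ Measurable ψ ∧
    ∀ᵐ t ∂volume.restrict T,
      ψ t ≤ subFinsler f N (γ t) (velocity V γ t) + ENNReal.ofReal ε ∧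
      (ψ t < ⊤ → MDifferentiableAt 𝓘(ℝ, ℝ) 𝓘(ℝ, V) γ t ∧ f (γ t) (u t) = velocity V γ t ∧
        ENNReal.ofReal (N (γ t) (u t)) ≤ ψ t)

theorem HasAlmostOptimalControl.mono {f : ∀ p : M, E →L[ℝ] TangentSpace 𝓘(ℝ, V) p}
    {N : M → E → ℝ} {γ : ℝ → M} {ε : ℝ} {S T : Set ℝ}
    (h : HasAlmostOptimalControl f N γ ε T) (hST : S ⊆ T) :
    HasAlmostOptimalControl f N γ ε S := by
  obtain ⟨u, ψ, hu, hψ, hae⟩ := h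
  exact ⟨u, ψ, hu, hψ, ae_restrict_of_ae_restrict_of_subset hST hae⟩

theorem HasAlmostOptimalControl.union {f : ∀ p : M, E →L[ℝ] TangentSpace 𝓘(ℝ, V) p}
    {N : M → E → ℝ} {γ : ℝ → M} {ε : ℝ} {S T : Set ℝ} (hSm : MeasurableSet S)
    (hTm : MeasurableSet T) (hS : HasAlmostOptimalControl f N γ ε S)
    (hT : HasAlmostOptimalControl f N γ ε T) :
    HasAlmostOptimalControl f N γ ε (S ∪ T) := by
  classical
  obtain ⟨u, ψ, hu, hψ, hae⟩ := hS
  obtain ⟨u', ψ', hu', hψ', hae'⟩ := hT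
  refine ⟨S.piecewise u u', S.piecewise ψ ψ', hu.piecewise hSm hu', hψ.piecewise hSm hψ', ?_⟩
  rw [ae_restrict_iff' hSm] at hae
  rw [ae_restrict_iff' hTm] at hae'
  rw [ae_restrict_iff' (hSm.union hTm)]
  filter_upwards [hae, hae'] with t h h' ht
  by_cases hts : t ∈ S
  · rw [piecewise_eq_of_mem _ _ _ hts, piecewise_eq_of_mem _ _ _ hts]
    exact h hts
  · rw [piecewise_eq_of_notMem _ _ _ hts, piecewise_eq_of_notMem _ _ _ hts]
    exact h' (ht.resolve_left hts)

theorem hasAlmostOptimalControl_Icc_of_chart [FiniteDimensional ℝ V] [FiniteDimensional ℝ E]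
    [IsManifold 𝓘(ℝ, V) ∞ M]
    (f : ∀ p : M, E →L[ℝ] TangentSpace 𝓘(ℝ, V) p) {N : M → E → ℝ}
    (hN : IsContinuouslyVaryingNorm N) {φ : OpenPartialHomeomorph M V}
    (hφ : φ ∈ IsManifold.maximalAtlas 𝓘(ℝ, V) ∞ M) (hf : ContinuousOn (coordRep f φ) φ.target)
    {γ : ℝ → M} {c d : ℝ} (hcd : c ≤ d) (hγ : ContinuousOn γ (Icc c d))
    (hm : MapsTo γ (Icc c d) φ.source)
    (hac : AbsolutelyContinuousOnInterval (fun t => φ (γ t)) c d) {ε : ℝ} (hε : 0 < ε) :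
    HasAlmostOptimalControl f N γ ε (Icc c d) := by
  classical
  borelize E V
  borelize (E →L[ℝ] V)
  -- Constant extension beyond `[c,d]`: the coefficients become continuous on all of `ℝ`, as the
  -- selection needs.
  let γ' : ℝ → M := fun t => γ (projIcc c d hcd t)
  have hγ' : Continuous γ' := hγ.domRestrict.comp continuous_projIcc
  have hγ's : ∀ t, γ' t ∈ φ.source := fun t => hm (projIcc c d hcd t).2
  have hγγ' : ∀ t ∈ Icc c d, γ' t = γ t := fun t ht => by simp [γ', projIcc_of_mem hcd ht]
  have hA : Continuous fun t => coordRep f φ (φ (γ' t)) :=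
    hf.comp_continuous (φ.continuousOn.comp_continuous hγ' hγ's) fun t => φ.map_source (hγ's t)
  have hw : Measurable (deriv fun t => φ (γ t)) := measurable_deriv _
  have hn : Continuous fun y : ℝ × E => N (γ' y.1) y.2 :=
    hN.continuous.comp ((hγ'.comp continuous_fst).prodMk continuous_snd)
  obtain ⟨u, hu, hS, hsel⟩ := exists_measurable_almost_minimizer hA.measurable hw
    (n := fun t e => N (γ' t) e) (fun t => hn.comp (continuous_const.prodMk continuous_id))
    (fun e => (hn.comp (continuous_id.prodMk continuous_const)).measurable)
    (fun t e => hN.nonneg _ _) hε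
  -- `ψ` is the cost of `u` where the velocity is in the image of `f`, and `⊤` elsewhere, where the
  -- sub-Finsler norm is an infimum over the empty set.
  refine ⟨u, {t | deriv (fun t => φ (γ t)) t ∈ range (coordRep f φ (φ (γ' t)))}.piecewise
    (fun t => ENNReal.ofReal (N (γ' t) (u t))) (fun _ => ⊤), hu.stronglyMeasurable,
    Measurable.piecewise hS
      (hn.measurable.comp (measurable_id.prodMk hu)).ennreal_ofReal measurable_const, ?_⟩
  have hdiff := hac.boundedVariationOn.ae_differentiableAt_of_mem_uIcc
  -- The endpoints are discarded because there `γ` is only continuous from within the interval.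
  have hc : ∀ᵐ t : ℝ, t ≠ c := by simp [ae_iff, measure_singleton]
  have hd : ∀ᵐ t : ℝ, t ≠ d := by simp [ae_iff, measure_singleton]
  rw [ae_restrict_iff' measurableSet_Icc]
  filter_upwards [hdiff, hc, hd] with t ht htc htd htI
  rw [uIcc_of_le hcd] at ht
  have hcont : ContinuousAt γ t := hγ.continuousAt
    (Icc_mem_nhds (lt_of_le_of_ne htI.1 htc.symm) (lt_of_le_of_ne htI.2 htd))
  have hmd := mdifferentiableAt_of_chart hφ (hm htI) hcont (ht htI)
  have hiff : ∀ e, f (γ t) e = velocity V γ t ↔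
      coordRep f φ (φ (γ' t)) e = deriv (fun s => φ (γ s)) t := fun e => by
    rw [hγγ' t htI]
    exact apply_eq_velocity_iff f hφ (hm htI) hmd e
  by_cases hts : deriv (fun t => φ (γ t)) t ∈ range (coordRep f φ (φ (γ' t)))
  · rw [piecewise_eq_of_mem _ _ _ (by exact hts)]
    obtain ⟨h1, h2⟩ := hsel t hts
    refine ⟨?_, fun _ => ⟨hmd, (hiff _).2 h1, by rw [hγγ' t htI]⟩⟩
    rw [← tsub_le_iff_right]
    refine le_iInf₂ fun e he => ?_
    rw [tsub_le_iff_right, ← ENNReal.ofReal_add (hN.nonneg _ _) hε.le]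
    have := h2 e ((hiff e).1 he)
    rw [hγγ' t htI] at this ⊢
    exact ENNReal.ofReal_le_ofReal this
  · rw [piecewise_eq_of_notMem _ _ _ (by exact hts)]
    refine ⟨?_, fun h => absurd h (lt_irrefl _)⟩
    rw [← tsub_le_iff_right]
    exact le_iInf₂ fun e he => absurd ⟨e, (hiff e).1 he⟩ hts

/-- The property holds near each time by working in one chart, and passes to subsets and finite
measurable unions, so compactness gives it on `[a,b]`. Measurable supersets `T` serve because
`IsCompact.induction_on` runs over arbitrary sets. -/
theorem IsAbsolutelyContinuousCurve.hasAlmostOptimalControl [FiniteDimensional ℝ V]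
    [FiniteDimensional ℝ E] [IsManifold 𝓘(ℝ, V) ∞ M]
    {f : ∀ p : M, E →L[ℝ] TangentSpace 𝓘(ℝ, V) p} (hf : IsLipschitzStructure f)
    {N : M → E → ℝ} (hN : IsContinuouslyVaryingNorm N) {γ : ℝ → M} {a b : ℝ}
    (hγ : IsAbsolutelyContinuousCurve V γ a b) {ε : ℝ} (hε : 0 < ε) :
    HasAlmostOptimalControl f N γ ε (Icc a b) := by
  suffices h : ∃ T, MeasurableSet T ∧ Icc a b ⊆ T ∧ HasAlmostOptimalControl f N γ ε T by
    obtain ⟨T, -, hT, h⟩ := h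
    exact h.mono hT
  refine isCompact_Icc.induction_on
    (p := fun S => ∃ T, MeasurableSet T ∧ S ⊆ T ∧ HasAlmostOptimalControl f N γ ε T) ?_ ?_ ?_ ?_
  · refine ⟨∅, MeasurableSet.empty, Subset.rfl, fun _ => 0, fun _ => 0,
      stronglyMeasurable_const, measurable_const, ?_⟩
    simp
  · rintro S S' hSS' ⟨T, hTm, hT, h⟩
    exact ⟨T, hTm, hSS'.trans hT, h⟩
  · rintro S S' ⟨T, hTm, hT, h⟩ ⟨T', hTm', hT', h'⟩
    exact ⟨T ∪ T', hTm.union hTm', union_subset_union hT hT', h.union hTm hTm' h'⟩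
  · intro x hx
    obtain ⟨φ, hφ, hxφ, L, hL⟩ := hf (γ x)
    have hnhds := (hγ.1 x hx).preimage_mem_nhdsWithin (φ.open_source.mem_nhds hxφ)
    obtain ⟨δ, hδ, hball⟩ := Metric.mem_nhdsWithin_iff.1 hnhds
    have hsub : Icc (max a (x - δ / 2)) (min b (x + δ / 2)) ⊆ γ ⁻¹' φ.source := by
      rintro t ⟨h1, h2⟩
      rw [max_le_iff] at h1
      rw [le_min_iff] at h2
      refine hball ⟨?_, h1.1, h2.1⟩
      rw [Metric.mem_ball, Real.dist_eq, abs_lt]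
      constructor <;> linarith
    have hle : max a (x - δ / 2) ≤ min b (x + δ / 2) :=
      (max_le hx.1 (by linarith)).trans (le_min hx.2 (by linarith))
    refine ⟨Icc (max a (x - δ / 2)) (min b (x + δ / 2)), ?_, _, measurableSet_Icc, Subset.rfl,
      hasAlmostOptimalControl_Icc_of_chart f hN hφ hL.continuousOn hle
        (hγ.1.mono (Icc_subset_Icc (le_max_left _ _) (min_le_left _ _))) hsub
        (hγ.2 φ hφ _ _ (le_max_left _ _) hle (min_le_left _ _) hsub) hε⟩
    refine Metric.mem_nhdsWithin_iff.2 ⟨δ / 2, by positivity, ?_⟩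
    rintro t ⟨ht, hta, htb⟩
    rw [Metric.mem_ball, Real.dist_eq, abs_lt] at ht
    exact ⟨max_le hta (by linarith), le_min htb (by linarith)⟩

end CarnotCaratheodory

end ControlSelection

/-! ### The two inequalities -/

section Comparison

namespace CarnotCaratheodory

variable {V : Type*} [NormedAddCommGroup V] [NormedSpace ℝ V]
  {M : Type*} [TopologicalSpace M] [ChartedSpace V M]
  {E : Type*} [NormedAddCommGroup E] [NormedSpace ℝ E]

/-- `N` has a positive lower bound on the compact set `K ×` unit sphere; homogeneity does the rest.
This turns a bound on the cost along a curve into an `L^∞` bound on the control. -/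
theorem IsContinuouslyVaryingNorm.exists_pos_mul_norm_le [FiniteDimensional ℝ E] {N : M → E → ℝ}
    (hN : IsContinuouslyVaryingNorm N) {K : Set M} (hK : IsCompact K) :
    ∃ c : ℝ, 0 < c ∧ ∀ p ∈ K, ∀ u, c * ‖u‖ ≤ N p u := by
  have : ProperSpace E := FiniteDimensional.proper ℝ E
  obtain ⟨c, hc, h⟩ := (hK.prod (isCompact_sphere (0 : E) 1)).exists_forall_le'
    hN.continuous.continuousOn (a := 0) fun x hx => by
      refine (hN.nonneg _ _).lt_of_ne' fun h0 => ?_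
      have h1 := hx.2
      rw [hN.eq_zero _ _ h0] at h1
      simp at h1
  refine ⟨c, hc, fun p hp u => ?_⟩
  rcases eq_or_ne u 0 with rfl | hu
  · simpa using hN.nonneg p 0
  · have hu' : 0 < ‖u‖ := norm_pos_iff.2 hu
    have h1 : c ≤ N p (‖u‖⁻¹ • u) := h (p, ‖u‖⁻¹ • u) ⟨hp, by simp [norm_smul, hu'.ne']⟩
    rw [hN.smul, abs_of_pos (by positivity), inv_mul_eq_div, le_div_iff₀ hu'] at h1
    exact h1

theorem iInf_subFinslerLength_le_energy {f : ∀ p : M, E →L[ℝ] TangentSpace 𝓘(ℝ, V) p}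
    {N : M → E → ℝ} (hN : IsContinuouslyVaryingNorm N) {a b : ℝ} (hab : a < b) {p : M}
    {u : ℝ → E} {γ : ℝ → M} (hγ : IsSolution f p u γ) :
    (⨅ (γ' : ℝ → M) (_ : IsAbsolutelyContinuousCurve V γ' a b) (_ : γ' a = p) (_ : γ' b = γ 1),
      subFinslerLength f N γ' a b) ≤ energy N u γ := by
  have hba : 0 < b - a := sub_pos.2 hab
  -- With constant density, `σ` is the inverse of `t ↦ a + (b - a) t`, taking `[a,b]` to `[0,1]`.
  obtain ⟨σ, hmono, ⟨K, hK⟩, hqmp, hder, hσ⟩ :=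
    exists_timeChange (locallyIntegrable_const (b - a)) hba (fun _ => le_rfl) 0 a
  have hσa : σ a = 0 := by simpa using hσ 0
  have hσb : σ b = 1 := by simpa using hσ 1
  have hmaps : MapsTo σ (Icc a b) (Icc 0 1) := by
    rw [← hσa, ← hσb]
    exact hmono.mapsTo_Icc
  refine iInf_le_of_le (fun t => γ (σ t)) (iInf₂_le_of_le ?_ ?_ (iInf_le_of_le ?_ ?_))
  · refine IsAbsolutelyContinuousCurve.comp_monotone_lipschitz ?_ hmono hK
    rw [hσa, hσb]
    exact hγ.absolutelyContinuous
  · simp only [hσa, hγ.initial]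
  · simp only [hσb]
  have hae := (hqmp.restrict hmaps).ae (hγ.equation.and (ENNReal.ae_le_essSup
    (fun t => ENNReal.ofReal (N (γ t) (u t)))))
  calc subFinslerLength f N (fun t => γ (σ t)) a b
      ≤ ∫⁻ _ in Icc a b, ENNReal.ofReal (b - a)⁻¹ * energy N u γ := by
        refine lintegral_mono_ae ?_
        filter_upwards [hae, ae_restrict_of_ae hder] with t ⟨⟨hmd, hvel⟩, hle⟩ hdt
        obtain ⟨-, hv⟩ := velocity_comp hmd hdt
        rw [hv, hvel]
        refine (iInf₂_le ((b - a)⁻¹ • u (σ t)) (map_smul (f (γ (σ t))) _ _)).trans ?_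
        rw [hN.smul, abs_of_pos (by positivity), ENNReal.ofReal_mul (by positivity)]
        gcongr
        exact hle
    _ = energy N u γ := by
        rw [lintegral_const, Measure.restrict_apply_univ, Real.volume_Icc, mul_right_comm,
          ← ENNReal.ofReal_mul (by positivity), inv_mul_cancel₀ hba.ne', ENNReal.ofReal_one,
          one_mul]

theorem ccDist_le_of_hasAlmostOptimalControl [FiniteDimensional ℝ E]
    {f : ∀ p : M, E →L[ℝ] TangentSpace 𝓘(ℝ, V) p} {N : M → E → ℝ}
    (hN : IsContinuouslyVaryingNorm N) {a b : ℝ} (hab : a < b) {γ : ℝ → M}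
    (hγ : IsAbsolutelyContinuousCurve V γ a b) {ε : ℝ} (hε : 0 < ε)
    (hc : HasAlmostOptimalControl f N γ ε (Icc a b)) (hfin : subFinslerLength f N γ a b < ⊤) :
    ccDist f N (γ a) (γ b) ≤
      subFinslerLength f N γ a b + ENNReal.ofReal (2 * ε * (b - a)) := by
  have hba : 0 < b - a := sub_pos.2 hab
  obtain ⟨u, ψ, hu, hψ, hae⟩ := hc
  -- The sub-Finsler speed is not known to be measurable; only monotonicity and the addition of a
  -- constant are used, and `ψ` replaces it from here on.
  have hψint : ∫⁻ t in Icc a b, ψ t ≤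
      subFinslerLength f N γ a b + ENNReal.ofReal (ε * (b - a)) := by
    refine (lintegral_mono_ae (hae.mono fun t ht => ht.1)).trans ?_
    rw [lintegral_add_right _ measurable_const, lintegral_const, Measure.restrict_apply_univ,
      Real.volume_Icc, ENNReal.ofReal_mul hε.le]
    rfl
  have hψtop : ∫⁻ t in Icc a b, ψ t ≠ ⊤ :=
    (hψint.trans_lt (ENNReal.add_lt_top.2 ⟨hfin, ENNReal.ofReal_lt_top⟩)).ne
  have hψae := ae_lt_top hψ hψtop
  have hψr : IntegrableOn (fun t => (ψ t).toReal) (Icc a b) :=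
    integrable_toReal_of_lintegral_ne_top hψ.aemeasurable hψtop
  -- The added `ε` bounds the density below even where the curve stands still; with the `ε` lost in
  -- the selection, it accounts for the factor `2`.
  let g : ℝ → ℝ := fun t => (Icc a b).indicator (fun t => (ψ t).toReal) t + ε
  have hgm : Measurable g := (hψ.ennreal_toReal.indicator measurableSet_Icc).add_const ε
  have hgε : ∀ t, ε ≤ g t := fun t =>
    le_add_of_nonneg_left (indicator_nonneg (fun _ _ => ENNReal.toReal_nonneg) t)
  have hgψ : ∀ t ∈ Icc a b, (ψ t).toReal ≤ g t := fun t ht => by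
    simp only [g, indicator_of_mem ht]
    linarith
  have hgloc : LocallyIntegrable g :=
    ((integrable_indicator_iff measurableSet_Icc).2 hψr).locallyIntegrable.add
      (locallyIntegrable_const ε)
  set L : ℝ := (∫⁻ t in Icc a b, ψ t).toReal + ε * (b - a) with hLdef
  have hL : 0 < L := by positivity
  have hgL : ∫ t in a..b, g t = L := by
    rw [intervalIntegral.integral_of_le hab.le, ← integral_Icc_eq_integral_Ioc,
      integral_add (((integrable_indicator_iff measurableSet_Icc).2 hψr).integrableOn)
        (integrable_const ε),
      setIntegral_indicator measurableSet_Icc, inter_self, integral_toReal hψ.aemeasurable hψae]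
    simp [hLdef, mul_comm, hab.le]
  have hLle : ENNReal.ofReal L ≤
      subFinslerLength f N γ a b + ENNReal.ofReal (2 * ε * (b - a)) := by
    rw [hLdef, ENNReal.ofReal_add ENNReal.toReal_nonneg (by positivity),
      ENNReal.ofReal_toReal hψtop]
    grw [hψint]
    rw [add_assoc, ← ENNReal.ofReal_add (by positivity) (by positivity)]
    apply le_of_eq
    congr 2
    ring
  obtain ⟨σ, hmono, ⟨K, hK⟩, hqmp, hder, hσ⟩ :=
    -- Dividing by `L` gives the density mass `1` on `[a,b]`, so that `σ` takes `[0,1]` to `[a,b]`.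
    exists_timeChange (h := fun t => L⁻¹ * g t) (LocallyIntegrable.smul hgloc L⁻¹) (c := L⁻¹ * ε)
      (by positivity) (fun t => by gcongr; exact hgε t) a 0
  have hσ0 : σ 0 = a := by simpa using hσ a
  have hσ1 : σ 1 = b := by
    have := hσ b
    rwa [intervalIntegral.integral_const_mul, hgL, inv_mul_cancel₀ hL.ne', zero_add] at this
  have hmaps : MapsTo σ (Icc 0 1) (Icc a b) := by
    rw [← hσ0, ← hσ1]
    exact hmono.mapsTo_Icc
  -- The scalar is `σ'(r)`, as the chain rule for `γ ∘ σ` demands.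
  let v : ℝ → E := fun r => (L⁻¹ * g (σ r))⁻¹ • u (σ r)
  have hv : StronglyMeasurable v :=
    (StronglyMeasurable.smul (hgm.const_mul L⁻¹).inv.stronglyMeasurable hu).comp_measurable
      hqmp.measurable
  have hall : ∀ᵐ r ∂volume.restrict (Icc (0 : ℝ) 1), σ r ∈ Icc a b ∧
      HasDerivAt σ (L⁻¹ * g (σ r))⁻¹ r ∧ MDifferentiableAt 𝓘(ℝ, ℝ) 𝓘(ℝ, V) γ (σ r) ∧
      f (γ (σ r)) (u (σ r)) = velocity V γ (σ r) ∧ N (γ (σ r)) (v r) ≤ L := by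
    filter_upwards [(hqmp.restrict hmaps).ae (hae.and hψae), ae_restrict_of_ae hder,
      ae_restrict_mem measurableSet_Icc] with r ⟨⟨_, h2⟩, h3⟩ hdr hr
    obtain ⟨h4, h5, h6⟩ := h2 h3
    refine ⟨hmaps hr, hdr, h4, h5, ?_⟩
    have hg0 : 0 < g (σ r) := hε.trans_le (hgε _)
    have h7 : N (γ (σ r)) (u (σ r)) ≤ g (σ r) :=
      (ENNReal.ofReal_le_iff_le_toReal h3.ne).1 h6 |>.trans (hgψ _ (hmaps hr))
    rw [hN.smul, abs_of_pos (by positivity), mul_inv, inv_inv, mul_assoc, inv_mul_eq_div]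
    exact mul_le_of_le_one_right hL.le ((div_le_one hg0).2 h7)
  obtain ⟨c, hc0, hcN⟩ := hN.exists_pos_mul_norm_le (isCompact_Icc.image_of_continuousOn hγ.1)
  have hmem : MemLp v ⊤ (volume.restrict (Icc (0 : ℝ) 1)) := by
    refine memLp_top_of_bound hv.aestronglyMeasurable (L / c) ?_
    filter_upwards [hall] with r hr
    rw [le_div_iff₀ hc0, mul_comm]
    exact (hcN _ (mem_image_of_mem γ hr.1) _).trans hr.2.2.2.2
  refine iInf₂_le_of_le v (fun r => γ (σ r)) (iInf₂_le_of_le hmem ⟨?_, ?_, ?_⟩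
    (iInf_le_of_le ?_ ?_))
  · refine IsAbsolutelyContinuousCurve.comp_monotone_lipschitz ?_ hmono hK
    rwa [hσ0, hσ1]
  · simp only [hσ0]
  · filter_upwards [hall] with r ⟨_, h1, h2, h3, _⟩
    obtain ⟨h4, h5⟩ := velocity_comp h2 h1
    refine ⟨h4, ?_⟩
    rw [h5, ← h3]
    exact (map_smul (f (γ (σ r))) _ _).symm
  · simp only [hσ1]
  · refine le_trans ?_ hLle
    refine essSup_le_of_ae_le _ ?_
    filter_upwards [hall] with r hr using ENNReal.ofReal_le_ofReal hr.2.2.2.2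

end CarnotCaratheodory

end Comparison

theorem corollary3p15
    {V : Type*} [NormedAddCommGroup V] [NormedSpace ℝ V] [FiniteDimensional ℝ V]
    {M : Type*} [TopologicalSpace M] [T2Space M] [SecondCountableTopology M]
    [ChartedSpace V M] [IsManifold 𝓘(ℝ, V) ∞ M]
    {E : Type*} [NormedAddCommGroup E] [NormedSpace ℝ E] [FiniteDimensional ℝ E]
    (f : ∀ p : M, E →L[ℝ] TangentSpace 𝓘(ℝ, V) p)
    (hf : CarnotCaratheodory.IsLipschitzStructure f)
    (N : M → E → ℝ) (hN : CarnotCaratheodory.IsContinuouslyVaryingNorm N)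
    (a b : ℝ) (hab : a < b) (p q : M) :
    CarnotCaratheodory.ccDist f N p q =
      ⨅ (γ : ℝ → M) (_ : CarnotCaratheodory.IsAbsolutelyContinuousCurve V γ a b)
        (_ : γ a = p) (_ : γ b = q), CarnotCaratheodory.subFinslerLength f N γ a b := by
  have hba : 0 < b - a := sub_pos.2 hab
  apply le_antisymm
  · refine le_iInf₂ fun γ hγ => le_iInf₂ fun hp hq => ?_
    subst hp hq
    refine ENNReal.le_of_forall_pos_le_add fun ε hε hfin => ?_
    have hε' : (0 : ℝ) < ε / (2 * (b - a)) := by positivity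
    refine (CarnotCaratheodory.ccDist_le_of_hasAlmostOptimalControl hN hab hγ hε'
      (hγ.hasAlmostOptimalControl hf hN hε') hfin).trans_eq ?_
    congr 1
    rw [show 2 * ((ε : ℝ) / (2 * (b - a))) * (b - a) = ε by field_simp, ENNReal.ofReal_coe_nnreal]
  · refine le_iInf₂ fun u γ => le_iInf₂ fun _ hγ => le_iInf fun hq => ?_
    subst hq
    exact CarnotCaratheodory.iInf_subFinslerLength_le_energy hN hab hγ
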